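/- Let $p$ be a prime. A topological group $G$ is called nearly simple if every closed subnormal subgroup of $G$ is open or discrete. A (finite-dimensional, analytic) $p$-adic Lie group $G$ with Lie algebra $L(G)=T_1(G)$ is called extraordinary if $G$ is nearly simple, $\mathrm{Ad}_G(g)=\mathrm{id}_{L(G)}$ for all $g\in G$ (where $\mathrm{Ad}_G(g)$ is the tangent map at $1$ of $x\mapsto gxg^{-1}$), and the commutator group $S'$ is non-discrete for each open subnormal subgroup $S\subseteq G$. The class of elementary groups is the smallest class of totally disconnected, locally compact, second countable groups which contains all countable discrete groups and all metrizable profinite groups and is closed under group extensions and under countable ascending unions of open subgroups. Let $\Sigma_0$ be the class of all topological groups which are countable and discrete, or metrizable and profinite. If $\lambda>0$ is a limit ordinal, let $\Sigma_\lambda:=\bigcup_{\mu<\lambda}\Sigma_\mu$. If $\lambda=\mu+1$, let $\Sigma_\lambda$ be the class of all topological groups $G$ such that (a) $G$ has a closed normal subgroup $N$ with $N\in\Sigma_\mu$ and $G/N\in\Sigma_0$, or (b) $G=\bigcup_{n\in\mathbb N}V_n$ for an ascending sequence $V_1\subseteq V_2\subseteq\cdots$ of open subgroups of $G$ with $V_n\in\Sigma_\mu$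 for all $n$. The construction rank $\mathrm{erk}(G)$ of an elementary group $G$ is the least ordinal $\lambda$ with $G\in\Sigma_\lambda$. Proposition. Let $G$ be an extraordinary $p$-adic Lie group. Then $G=\bigcup_{n\in\mathbb N}G_n$ with open subgroups $G_1\subseteq G_2\subseteq\cdots$ of $G$ such that the centre of each $G_n$ is open in $G_n$. Hence, if $G$ is $\sigma$-compact, then $G$ is elementary and $\mathrm{erk}(G)\leq 2$. -/

import Mathlib

universe u v

/-- A topological group is *nearly simple* if each of its closed subnormal subgroups is
open or discrete. -/
def IsNearlySimple (G : Type u) [Group G] [TopologicalSpace G] : Prop :=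
  ∀ S : Subgroup G, S.IsSubnormal → IsClosed (S : Set G) →
    IsOpen (S : Set G) ∨ DiscreteTopology S

section padic

open scoped Manifold ContDiff

variable (p : ℕ) [Fact p.Prime]
  (E : Type v) [NormedAddCommGroup E] [NormedSpace ℚ_[p] E]
  (G : Type u) [TopologicalSpace G] [ChartedSpace E G] [Group G]

/-- The map `Ad g : L(G) → L(G)`, the tangent map at `1` of the inner automorphism
`x ↦ g * x * g⁻¹` of a `p`-adic Lie group. The `cast` identifies the tangent space at
`g * 1 * g⁻¹` with the one at `1` (these points are equal). -/
noncomputable def adjointMap (g : G) :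
    GroupLieAlgebra 𝓘(ℚ_[p], E) G →L[ℚ_[p]] GroupLieAlgebra 𝓘(ℚ_[p], E) G :=
  have h : g * 1 * g⁻¹ = 1 := by group
  cast (congrArg (fun y : G =>
      TangentSpace 𝓘(ℚ_[p], E) (1 : G) →L[ℚ_[p]] TangentSpace 𝓘(ℚ_[p], E) y) h)
    (mfderiv 𝓘(ℚ_[p], E) 𝓘(ℚ_[p], E) (fun x : G => g * x * g⁻¹) 1)

/-- A `p`-adic Lie group `G` (modelled on `E`) is *extraordinary* if it is nearly simple,
`G = ker Ad_G`, and the commutator group of every open subnormal subgroup of `G` is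
non-discrete. -/
structure IsExtraordinary : Prop where
  nearlySimple : IsNearlySimple G
  adjoint_trivial : ∀ g : G,
    adjointMap p E G g = ContinuousLinearMap.id ℚ_[p] (GroupLieAlgebra 𝓘(ℚ_[p], E) G)
  commutator_not_discrete : ∀ S : Subgroup G, S.IsSubnormal → IsOpen (S : Set G) →
    ¬ DiscreteTopology (⁅S, S⁆ : Subgroup G)

end padic

/-- Metrizable profinite topological groups. -/
structure IsMetrizableProfinite (G : Type u) [Group G] [TopologicalSpace G] : Prop where
  isTopologicalGroup : IsTopologicalGroup G
  compact : CompactSpace G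
  totallyDisconnected : TotallyDisconnectedSpace G
  metrizable : TopologicalSpace.MetrizableSpace G

/-- Totally disconnected, locally compact (Hausdorff), second countable topological groups. -/
structure IsTDLCSC (G : Type u) [Group G] [TopologicalSpace G] : Prop where
  isTopologicalGroup : IsTopologicalGroup G
  t2 : T2Space G
  locallyCompact : LocallyCompactSpace G
  totallyDisconnected : TotallyDisconnectedSpace G
  secondCountable : SecondCountableTopology G

/-- The class of elementary groups: the smallest class of totally disconnected, locally compact,
second countable groups which contains the countable discrete groups and the metrizable profinite
groups, and is closed under group extensions and under countable ascending unions of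
open subgroups. -/
inductive IsElementary : (G : Type u) → [Group G] → [TopologicalSpace G] → Prop
  | discrete (G : Type u) [Group G] [TopologicalSpace G] :
      Countable G → DiscreteTopology G → IsElementary G
  | profinite (G : Type u) [Group G] [TopologicalSpace G] :
      IsMetrizableProfinite G → IsElementary G
  | extension (G : Type u) [Group G] [TopologicalSpace G] (N : Subgroup G) [N.Normal] :
      IsTDLCSC G → IsClosed (N : Set G) → IsElementary N → IsElementary (G ⧸ N) →
      IsElementary G
  | union (G : Type u) [Group G] [TopologicalSpace G] (V : ℕ → Subgroup G) :
      IsTDLCSC G → Monotone V → (∀ n, IsOpen (V n : Set G)) →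
      (⋃ n, (V n : Set G)) = Set.univ → (∀ n, IsElementary (V n)) → IsElementary G

/-- The class `Σ₀` of topological groups which are countable and discrete, or metrizable and
profinite. -/
def InSigmaZero (G : Type u) [Group G] [TopologicalSpace G] : Prop :=
  (Countable G ∧ DiscreteTopology G) ∨ IsMetrizableProfinite G

/-- `InSigma l G` says that the topological group `G` belongs to the class `Σ_l`, defined by
transfinite recursion on the ordinal `l`. -/
inductive InSigma : Ordinal.{u} → (G : Type u) → [Group G] → [TopologicalSpace G] → Prop
  | zero (G : Type u) [Group G] [TopologicalSpace G] : InSigmaZero G → InSigma 0 G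
  | limit (l m : Ordinal.{u}) (G : Type u) [Group G] [TopologicalSpace G] :
      Order.IsSuccLimit l → m < l → InSigma m G → InSigma l G
  | extension (m : Ordinal.{u}) (G : Type u) [Group G] [TopologicalSpace G]
      (N : Subgroup G) [N.Normal] :
      IsTopologicalGroup G → IsClosed (N : Set G) → InSigma m N → InSigmaZero (G ⧸ N) →
      InSigma (Order.succ m) G
  | union (m : Ordinal.{u}) (G : Type u) [Group G] [TopologicalSpace G] (V : ℕ → Subgroup G) :
      IsTopologicalGroup G → Monotone V → (∀ n, IsOpen (V n : Set G)) →
      (⋃ n, (V n : Set G)) = Set.univ → (∀ n, InSigma m (V n)) →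
      InSigma (Order.succ m) G

/-- The construction rank of a topological group: the least ordinal `l` such that `G ∈ Σ_l`,
and `⊤` if there is no such ordinal. -/
noncomputable def constructionRank (G : Type u) [Group G] [TopologicalSpace G] :
    WithTop Ordinal.{u} :=
  ⨅ l ∈ {l : Ordinal.{u} | InSigma l G}, (l : WithTop Ordinal.{u})

/-! Triviality of `Ad` forces every `g` to commute with a neighbourhood of `1`, and the rest is
topology. In a chart at `1`, conjugation `f` by `g` differs from the identity by a quadratic error,
and it commutes with `s : x ↦ x ^ p`, whose derivative at `1` is `p`, of norm `1/p`. Along an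
`s`-orbit the displacement `f y - y` shrinks only about like `p⁻ⁿ`, since `s` carries it along; the
quadratic bound makes it shrink like `p⁻²ⁿ`. Hence it vanishes
(`eventually_eq_self_of_commute_padic`). By Baire, the centralizer of some basic neighbourhood of
`1` is open, which yields an open commutative subgroup `A`. The centralizers of `W n ∩ A`, for
shrinking `W n`, exhaust `G` and have open centres. A compact open subgroup inside such a centre is
normal with discrete quotient: one extension, then one union, gives rank at most 2. -/

open Filter Topology Asymptotics
open scoped Manifold ContDiff

/-! ### Rigidity near an attracting fixed point -/

/-- A self-map of a `p`-adic normed space which is tangent to the identity to second order at a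
fixed point, and which commutes with a map with derivative `p` there, is the identity nearby. -/
theorem eventually_eq_self_of_commute_padic {p : ℕ} [Fact p.Prime]
    {E : Type*} [NormedAddCommGroup E] [NormedSpace ℚ_[p] E] {f s : E → E} {z : E}
    (hf : (fun y => f y - y) =O[𝓝 z] fun y => ‖y - z‖ ^ 2) (hsz : s z = z)
    (hs : HasStrictFDerivAt s ((p : ℚ_[p]) • ContinuousLinearMap.id ℚ_[p] E) z)
    (hcomm : ∀ᶠ x in 𝓝 z, f (s x) = s (f x)) : ∀ᶠ x in 𝓝 z, f x = x := by
  have hp : (0 : ℝ) < p := by exact_mod_cast (Fact.out : p.Prime).pos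
  have hp2 : (2 : ℝ) ≤ p := by exact_mod_cast (Fact.out : p.Prime).two_le
  set q : ℝ := (p : ℝ)⁻¹ with hq
  have hq0 : 0 < q := inv_pos.mpr hp
  have hq2 : q ≤ 1 / 2 := by
    rw [hq, one_div]; exact inv_anti₀ (by norm_num) hp2
  obtain ⟨C, hC0, hC⟩ := hf.exists_pos
  have hfc : Tendsto f (𝓝 z) (𝓝 z) := by
    have h1 : Tendsto (fun y => f y - y) (𝓝 z) (𝓝 0) := by
      refine hf.trans_tendsto ?_
      have : Continuous fun y : E => ‖y - z‖ ^ 2 := by fun_prop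
      simpa using this.tendsto z
    simpa using h1.add tendsto_id
  have happ : ∀ᶠ w in 𝓝 z ×ˢ 𝓝 z,
      q * (9 / 10) * ‖w.1 - w.2‖ ≤ ‖s w.1 - s w.2‖ ∧
        ‖s w.1 - s w.2‖ ≤ q * (11 / 10) * ‖w.1 - w.2‖ := by
    -- The tolerance `q / 10` suffices because `(11/10)² / (9/10) < 2 ≤ p`.
    have h := hs.isLittleO.def (c := q / 10) (by positivity)
    rw [nhds_prod_eq] at h
    filter_upwards [h] with w hw
    have hn : ‖((p : ℚ_[p]) • ContinuousLinearMap.id ℚ_[p] E) (w.1 - w.2)‖ = q * ‖w.1 - w.2‖ := by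
      simp [norm_smul, hq]
    have h1 := norm_sub_norm_le (s w.1 - s w.2)
      (((p : ℚ_[p]) • ContinuousLinearMap.id ℚ_[p] E) (w.1 - w.2))
    have h2 := norm_sub_norm_le
      (((p : ℚ_[p]) • ContinuousLinearMap.id ℚ_[p] E) (w.1 - w.2)) (s w.1 - s w.2)
    rw [norm_sub_rev _ (s w.1 - s w.2)] at h2
    rw [hn] at h1 h2
    constructor <;> nlinarith
  -- The two-point estimate is used at `(x, z)` for contraction and at `(f x, x)` for the lower
  -- bound on displacement.
  obtain ⟨P, hP, Q, hQ, hPQ⟩ := eventually_prod_iff.mp happ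
  have hall : ∀ᶠ x in 𝓝 z, P x ∧ Q x ∧ P (f x) ∧ ‖f x - x‖ ≤ C * ‖x - z‖ ^ 2 ∧
      f (s x) = s (f x) := by
    filter_upwards [hP, hQ, hfc.eventually hP, hC.bound, hcomm] with x h1 h2 h3 h4 h5
    refine ⟨h1, h2, h3, ?_, h5⟩
    simpa using h4
  obtain ⟨r, hr, hball⟩ := Metric.eventually_nhds_iff_ball.mp hall
  have hQz : Q z := hQ.self_of_nhds
  have hstep : ∀ x ∈ Metric.ball z r, ‖s x - z‖ ≤ q * (11 / 10) * ‖x - z‖ := by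
    intro x hx
    have := (@hPQ x (hball x hx).1 z hQz).2
    simpa [hsz] using this
  have hit : ∀ x ∈ Metric.ball z r, ∀ n : ℕ, s^[n] x ∈ Metric.ball z r ∧
      ‖s^[n] x - z‖ ≤ (q * (11 / 10)) ^ n * ‖x - z‖ ∧
      (q * (9 / 10)) ^ n * ‖f x - x‖ ≤ ‖f (s^[n] x) - s^[n] x‖ := by
    intro x hx n
    induction n with
    | zero => simpa using hx
    | succ n ih =>
      obtain ⟨h1, h2, h3⟩ := ih
      rw [Function.iterate_succ_apply']
      have h4 := hstep _ h1
      obtain ⟨-, hb, hc, -, he⟩ := hball _ h1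
      refine ⟨?_, ?_, ?_⟩
      · rw [mem_ball_iff_norm] at h1 ⊢
        nlinarith [norm_nonneg (s^[n] x - z)]
      · calc _ ≤ _ := h4
          _ ≤ q * (11 / 10) * ((q * (11 / 10)) ^ n * ‖x - z‖) := by gcongr
          _ = _ := by ring
      · rw [he]
        calc _ = q * (9 / 10) * ((q * (9 / 10)) ^ n * ‖f x - x‖) := by ring
          _ ≤ q * (9 / 10) * ‖f (s^[n] x) - s^[n] x‖ := by gcongr
          _ ≤ _ := (hPQ hc hb).1
  filter_upwards [Metric.ball_mem_nhds z hr] with x hx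
  -- The ratio of the quadratic upper rate `(11q/10)²` to the lower rate `9q/10`.
  set t : ℝ := q * (121 / 90) with ht
  have ht1 : t < 1 := by rw [ht]; linarith
  have ht0 : 0 ≤ t := by positivity
  have hbound : ∀ n : ℕ, ‖f x - x‖ ≤ t ^ n * (C * ‖x - z‖ ^ 2) := by
    intro n
    obtain ⟨h1, h2, h3⟩ := hit x hx n
    have h4 := (hball _ h1).2.2.2.1
    have h5 : ‖s^[n] x - z‖ ^ 2 ≤ ((q * (11 / 10)) ^ n * ‖x - z‖) ^ 2 := by gcongr
    have hpos : 0 < (q * (9 / 10)) ^ n := by positivity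
    refine le_of_mul_le_mul_left ?_ hpos
    calc _ ≤ _ := h3
      _ ≤ _ := h4
      _ ≤ C * ((q * (11 / 10)) ^ n * ‖x - z‖) ^ 2 := by gcongr
      _ = ((q * (11 / 10)) ^ 2) ^ n * (C * ‖x - z‖ ^ 2) := by
        rw [mul_pow _ ‖x - z‖, ← pow_mul, ← pow_mul, mul_comm n]; ring
      _ = (q * (9 / 10) * t) ^ n * (C * ‖x - z‖ ^ 2) := by
        congr 2; rw [ht]; ring
      _ = _ := by rw [mul_pow]; ring
  have hlim : Tendsto (fun n : ℕ => t ^ n * (C * ‖x - z‖ ^ 2)) atTop (𝓝 0) := by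
    simpa using (tendsto_pow_atTop_nhds_zero_of_lt_one ht0 ht1).mul_const (C * ‖x - z‖ ^ 2)
  have := ge_of_tendsto' hlim hbound
  rwa [norm_le_zero_iff, sub_eq_zero] at this

/-! ### Centralizers and Baire category -/

section centralizers

variable {G : Type*} [Group G] [TopologicalSpace G] [IsTopologicalGroup G] [T2Space G]

/-- A Baire group in which every element commutes with a neighbourhood of `1` has an
open commutative subgroup. -/
theorem exists_isOpen_subgroup_commute [FirstCountableTopology G] [BaireSpace G]
    (h : ∀ g : G, ∀ᶠ x in 𝓝 (1 : G), Commute g x) :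
    ∃ A : Subgroup G, IsOpen (A : Set G) ∧ ∀ x ∈ A, ∀ y ∈ A, Commute x y := by
  obtain ⟨W, hW⟩ := (𝓝 (1 : G)).exists_antitone_basis
  obtain ⟨n, hn⟩ := nonempty_interior_of_iUnion_of_closed
    (f := fun n => (Subgroup.centralizer (W n) : Set G))
    (fun n => Set.isClosed_centralizer (W n)) (by
      refine Set.eq_univ_of_forall fun g => ?_
      obtain ⟨n, -, hn⟩ := hW.1.mem_iff.mp (h g)
      exact Set.mem_iUnion.mpr ⟨n, fun x hx => ((hn hx : Commute g x)).symm⟩)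
  obtain ⟨x, hx⟩ := hn
  have hopen : IsOpen (Subgroup.centralizer (W n) : Set G) :=
    Subgroup.isOpen_of_mem_nhds _ (mem_interior_iff_mem_nhds.mp hx)
  -- Of two elements of `S`, one lies in `W n` and the other centralizes `W n`, so they commute.
  set S : Set G := W n ∩ Subgroup.centralizer (W n)
  have hS : S ∈ 𝓝 (1 : G) :=
    inter_mem (hW.1.mem_of_mem trivial) (hopen.mem_nhds (one_mem _))
  have hcomm : ∀ x ∈ S, ∀ y ∈ S, x * y = y * x := fun x hx y hy => hy.2 x hx.1
  refine ⟨Subgroup.closure S,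
    Subgroup.isOpen_of_mem_nhds _ (mem_of_superset hS Subgroup.subset_closure), ?_⟩
  intro x hx y hy
  have := Subgroup.isMulCommutative_closure hcomm
  exact congrArg Subtype.val (mul_comm' (⟨x, hx⟩ : Subgroup.closure S) ⟨y, hy⟩)

/-- A Baire group in which every element commutes with a neighbourhood of `1` is an ascending
union of open subgroups with open centres. -/
theorem exists_monotone_isOpen_center [FirstCountableTopology G] [BaireSpace G]
    (h : ∀ g : G, ∀ᶠ x in 𝓝 (1 : G), Commute g x) :
    ∃ H : ℕ → Subgroup G, Monotone H ∧ (∀ n, IsOpen (H n : Set G)) ∧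
      (⋃ n, (H n : Set G)) = Set.univ ∧
      ∀ n, IsOpen (Subgroup.center (H n) : Set (H n)) := by
  obtain ⟨A, hA, hcomm⟩ := exists_isOpen_subgroup_commute h
  obtain ⟨W, hW⟩ := (𝓝 (1 : G)).exists_antitone_basis
  have hle : ∀ n, A ≤ Subgroup.centralizer (W n ∩ A) := fun n x hx y hy => hcomm y hy.2 x hx
  -- Intersecting with `A` makes each centralizer contain `A`, hence open, and puts `W n ∩ A` in its
  -- centre.
  refine ⟨fun n => Subgroup.centralizer (W n ∩ A), ?_, ?_, ?_, ?_⟩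
  · exact fun m n hmn => Subgroup.centralizer_le (Set.inter_subset_inter_left _ (hW.2 hmn))
  · exact fun n => Subgroup.isOpen_mono (hle n) hA
  · refine Set.eq_univ_of_forall fun g => ?_
    obtain ⟨n, -, hn⟩ := hW.1.mem_iff.mp (h g)
    exact Set.mem_iUnion.mpr ⟨n, fun x hx => ((hn hx.1 : Commute g x)).symm⟩
  · intro n
    refine Subgroup.isOpen_of_mem_nhds (g := 1) _ ?_
    rw [nhds_subtype_eq_comap]
    refine mem_of_superset (preimage_mem_comap
      (inter_mem (hW.1.mem_of_mem (i := n) trivial) (hA.mem_nhds (one_mem A)))) ?_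
    intro x hx
    refine Subgroup.mem_center_iff.mpr fun g => Subtype.ext ?_
    exact (g.2 x.1 hx).symm

end centralizers

/-! ### Compact open subgroups -/

section vanDantzig

variable {G : Type u} [Group G] [TopologicalSpace G] [IsTopologicalGroup G]

/-- A compact open neighbourhood of `1` contains an open subgroup. -/
theorem exists_isOpen_subgroup_subset_of_isCompact {V : Set G} (hV : IsCompact V)
    (hVo : IsOpen V) (h1 : (1 : G) ∈ V) : ∃ K : Subgroup G, IsOpen (K : Set G) ∧ (K : Set G) ⊆ V := by
  obtain ⟨T, hT, hVT⟩ := compact_open_separated_mul_right hV hVo subset_rfl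
  -- The stabilizer of `V` under right translation; it contains `T ∩ T⁻¹`, and lies in `V` because
  -- `1 ∈ V`.
  let K : Subgroup G :=
    { carrier := {g | ∀ v, v * g ∈ V ↔ v ∈ V}
      one_mem' := fun v => by rw [mul_one]
      mul_mem' := fun {a b} ha hb v => by rw [← mul_assoc, hb, ha]
      inv_mem' := fun {a} ha v => by rw [← ha (v * a⁻¹), inv_mul_cancel_right] }
  refine ⟨K, Subgroup.isOpen_of_mem_nhds (g := 1) _ ?_, fun g hg => by
    simpa using (hg 1).mpr h1⟩
  filter_upwards [hT, inv_mem_nhds_one G hT] with g hg hg' v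
  refine ⟨fun hv => ?_, fun hv => hVT (Set.mul_mem_mul hv hg)⟩
  simpa using hVT (Set.mul_mem_mul hv hg')

/-- Van Dantzig's theorem. -/
theorem exists_isCompact_isOpen_subgroup_subset [T2Space G] [LocallyCompactSpace G]
    [TotallyDisconnectedSpace G] {U : Set G} (hU : U ∈ 𝓝 (1 : G)) :
    ∃ K : Subgroup G, IsOpen (K : Set G) ∧ IsCompact (K : Set G) ∧ (K : Set G) ⊆ U := by
  obtain ⟨C, hC, hCU, hCc⟩ := local_compact_nhds hU
  obtain ⟨V, hV, h1V, hVC⟩ :=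
    loc_compact_Haus_tot_disc_of_zero_dim.mem_nhds_iff.mp hC
  obtain ⟨K, hK, hKV⟩ := exists_isOpen_subgroup_subset_of_isCompact
    (hCc.of_isClosed_subset hV.1 hVC) hV.2 h1V
  exact ⟨K, hK, hCc.of_isClosed_subset (K.isClosed_of_isOpen hK) (hKV.trans hVC),
    hKV.trans (hVC.trans hCU)⟩

end vanDantzig

/-! ### Elementary groups and construction rank -/

theorem IsTDLCSC.of_isOpen {G : Type u} [Group G] [TopologicalSpace G] (hG : IsTDLCSC G)
    {H : Subgroup G} (hH : IsOpen (H : Set G)) : IsTDLCSC H := by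
  obtain ⟨_, _, _, _, _⟩ := hG
  have := TopologicalSpace.Subtype.secondCountableTopology (H : Set G)
  exact ⟨inferInstance, inferInstance, hH.locallyCompactSpace, inferInstance, this⟩

/-- A group with open centre is an extension of a countable discrete group by a metrizable
profinite one. -/
theorem exists_normal_isMetrizableProfinite {G : Type u} [Group G] [TopologicalSpace G]
    (hG : IsTDLCSC G) (hZ : IsOpen (Subgroup.center G : Set G)) :
    ∃ K : Subgroup G, K.Normal ∧ IsClosed (K : Set G) ∧ IsMetrizableProfinite K ∧
      Countable (G ⧸ K) ∧ DiscreteTopology (G ⧸ K) := by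
  obtain ⟨_, _, _, _, _⟩ := hG
  obtain ⟨K, hK, hKc, hKZ⟩ := exists_isCompact_isOpen_subgroup_subset
    (hZ.mem_nhds (one_mem (Subgroup.center G)))
  have : CompactSpace K := isCompact_iff_compactSpace.mp hKc
  have : SecondCountableTopology K := TopologicalSpace.Subtype.secondCountableTopology (K : Set G)
  have : DiscreteTopology (G ⧸ K) := QuotientGroup.discreteTopology hK
  refine ⟨K, ⟨fun n hn g => ?_⟩, K.isClosed_of_isOpen hK,
    ⟨inferInstance, inferInstance, inferInstance, inferInstance⟩, ?_, inferInstance⟩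
  · rwa [Subgroup.mem_center_iff.mp (hKZ hn) g, mul_inv_cancel_right]
  · have : SecondCountableTopology (G ⧸ K) := inferInstance
    exact (TopologicalSpace.separableSpace_iff_countable).mp inferInstance

theorem isElementary_of_isOpen_center {G : Type u} [Group G] [TopologicalSpace G]
    (hG : IsTDLCSC G) (hZ : IsOpen (Subgroup.center G : Set G)) : IsElementary G := by
  obtain ⟨K, _, hK, hKp, hc, hd⟩ := exists_normal_isMetrizableProfinite hG hZ
  exact .extension G K hG hK (.profinite K hKp) (.discrete _ hc hd)

theorem inSigma_one_of_isOpen_center {G : Type u} [Group G] [TopologicalSpace G]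
    (hG : IsTDLCSC G) (hZ : IsOpen (Subgroup.center G : Set G)) :
    InSigma (Order.succ 0) G := by
  obtain ⟨K, _, hK, hKp, hc, hd⟩ := exists_normal_isMetrizableProfinite hG hZ
  exact .extension 0 G K hG.1 hK (.zero K (.inr hKp)) (.inl ⟨hc, hd⟩)

theorem isElementary_and_constructionRank_le_two {G : Type u} [Group G] [TopologicalSpace G]
    (hG : IsTDLCSC G) {H : ℕ → Subgroup G} (hm : Monotone H) (ho : ∀ n, IsOpen (H n : Set G))
    (hu : (⋃ n, (H n : Set G)) = Set.univ)
    (hZ : ∀ n, IsOpen (Subgroup.center (H n) : Set (H n))) :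
    IsElementary G ∧ constructionRank G ≤ ((2 : Ordinal.{u}) : WithTop Ordinal.{u}) := by
  refine ⟨.union G H hG hm ho hu fun n =>
    isElementary_of_isOpen_center (hG.of_isOpen (ho n)) (hZ n), iInf₂_le _ ?_⟩
  have h : InSigma (Order.succ (Order.succ 0)) G := .union _ G H hG.1 hm ho hu fun n =>
    inSigma_one_of_isOpen_center (hG.of_isOpen (ho n)) (hZ n)
  have h2 : (2 : Ordinal.{u}) = Order.succ (Order.succ 0) := by
    simp [one_add_one_eq_two]
  exact h2 ▸ h

/-! ### Topology of `p`-adic manifolds -/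

theorem totallyDisconnectedSpace_of_padic (p : ℕ) [Fact p.Prime] (E : Type*)
    [NormedAddCommGroup E] [NormedSpace ℚ_[p] E] [FiniteDimensional ℚ_[p] E] :
    TotallyDisconnectedSpace E :=
  (ContinuousLinearEquiv.ofFinrankEq (𝕜 := ℚ_[p]) (E := E)
    (F := Fin (Module.finrank ℚ_[p] E) → ℚ_[p]) (by simp)).toHomeomorph.symm.totallyDisconnectedSpace

/-- A Hausdorff space locally homeomorphic to a totally disconnected locally compact Hausdorff space
is totally disconnected. -/
theorem ChartedSpace.totallyDisconnectedSpace (E M : Type*) [TopologicalSpace E] [T2Space E]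
    [LocallyCompactSpace E] [TotallyDisconnectedSpace E] [TopologicalSpace M] [T2Space M]
    [ChartedSpace E M] : TotallyDisconnectedSpace M := by
  suffices TotallySeparatedSpace M from inferInstance
  refine totallySeparatedSpace_iff_exists_isClopen.mpr fun x y hxy => ?_
  let e := chartAt E x
  have hU : IsOpen (e.target ∩ e.symm ⁻¹' {y}ᶜ) :=
    e.symm.isOpen_inter_preimage isOpen_compl_singleton
  have hx : e x ∈ e.target ∩ e.symm ⁻¹' {y}ᶜ := by
    refine ⟨mem_chart_target E x, ?_⟩
    simpa [e.left_inv (mem_chart_source E x)] using hxy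
  obtain ⟨C, hC, hCU, hCc⟩ := local_compact_nhds (hU.mem_nhds hx)
  obtain ⟨V, hV, hxV, hVC⟩ := loc_compact_Haus_tot_disc_of_zero_dim.mem_nhds_iff.mp hC
  have hVt : V ⊆ e.target := fun v hv => (hCU (hVC hv)).1
  -- The image of `V` is open by the chart, and closed as a compact set in a Hausdorff space.
  refine ⟨e.symm '' V, ⟨IsCompact.isClosed ?_, ?_⟩, ⟨e x, hxV, e.left_inv (mem_chart_source E x)⟩, ?_⟩
  · exact (hCc.of_isClosed_subset hV.1 hVC).image_of_continuousOn (e.continuousOn_symm.mono hVt)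
  · exact e.symm.isOpen_image_of_subset_source hV.2 hVt
  · rintro ⟨v, hv, rfl⟩
    exact (hCU (hVC hv)).2 rfl

theorem ChartedSpace.firstCountableTopology (E M : Type*) [TopologicalSpace E]
    [FirstCountableTopology E] [TopologicalSpace M] [ChartedSpace E M] :
    FirstCountableTopology M := by
  refine ⟨fun x => ?_⟩
  rw [← (chartAt E x).symm_map_nhds_eq (mem_chart_source E x)]
  infer_instance

/-! ### Lie group maps in a chart at the identity -/

section LieGroup

variable {𝕜 : Type*} [NontriviallyNormedField 𝕜] {E : Type*} [NormedAddCommGroup E]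
  [NormedSpace 𝕜 E] {G : Type*} [TopologicalSpace G] [ChartedSpace E G] [Group G]

/-- A map `F : G → G`, read in the preferred chart at `1`. -/
def inUnitChart (𝕜 : Type*) [NontriviallyNormedField 𝕜] {E : Type*} [NormedAddCommGroup E]
    [NormedSpace 𝕜 E] {G : Type*} [TopologicalSpace G] [ChartedSpace E G] [Group G]
    (F : G → G) : E → E :=
  extChartAt 𝓘(𝕜, E) (1 : G) ∘ F ∘ (extChartAt 𝓘(𝕜, E) (1 : G)).symm

theorem tendsto_extChartAt_symm_one :
    Tendsto (extChartAt 𝓘(𝕜, E) (1 : G)).symm (𝓝 (extChartAt 𝓘(𝕜, E) (1 : G) 1)) (𝓝 1) := by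
  have := continuousAt_extChartAt_symm (I := 𝓘(𝕜, E)) (1 : G)
  simpa [ContinuousAt] using this

theorem inUnitChart_one {F : G → G} (hF1 : F 1 = 1) :
    inUnitChart 𝕜 F (extChartAt 𝓘(𝕜, E) (1 : G) 1) = extChartAt 𝓘(𝕜, E) (1 : G) 1 := by
  simp [inUnitChart, hF1]

/-- Holds only near the base point, where `F'` stays in the chart domain. It transfers the
commutation of conjugation and powers to the chart. -/
theorem inUnitChart_comp {F F' : G → G} (hF : ContinuousAt F' 1) (hF1 : F' 1 = 1) :
    ∀ᶠ y in 𝓝 (extChartAt 𝓘(𝕜, E) (1 : G) 1),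
      inUnitChart 𝕜 F (inUnitChart 𝕜 F' y) = inUnitChart 𝕜 (F ∘ F') y := by
  have h1 : Tendsto F' (𝓝 1) (𝓝 1) := by simpa [ContinuousAt, hF1] using hF
  filter_upwards [(h1.comp (tendsto_extChartAt_symm_one (𝕜 := 𝕜) (E := E))).eventually
    (extChartAt_source_mem_nhds (I := 𝓘(𝕜, E)) (1 : G))] with y hy
  simp only [inUnitChart, Function.comp_apply] at hy ⊢
  rw [PartialEquiv.left_inv _ hy]

theorem analyticAt_inUnitChart_mul [CompleteSpace E] [LieGroup 𝓘(𝕜, E) ω G] :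
    AnalyticAt 𝕜 (fun q : E × E => extChartAt 𝓘(𝕜, E) (1 : G)
      ((extChartAt 𝓘(𝕜, E) (1 : G)).symm q.1 * (extChartAt 𝓘(𝕜, E) (1 : G)).symm q.2))
      (extChartAt 𝓘(𝕜, E) (1 : G) 1, extChartAt 𝓘(𝕜, E) (1 : G) 1) := by
  refine ContDiffAt.analyticAt (contMDiffAt_iff_contDiffAt.mp ?_)
  set z := extChartAt 𝓘(𝕜, E) (1 : G) 1 with hz
  have hsymm : ContMDiffAt 𝓘(𝕜, E) 𝓘(𝕜, E) ω (extChartAt 𝓘(𝕜, E) (1 : G)).symm z :=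
    (contMDiffOn_extChartAt_symm (1 : G)).contMDiffAt (extChartAt_target_mem_nhds (1 : G))
  have hfst : ContMDiffAt 𝓘(𝕜, E × E) 𝓘(𝕜, E) ω (Prod.fst : E × E → E) (z, z) :=
    contDiff_fst.contMDiff.contMDiffAt
  have hsnd : ContMDiffAt 𝓘(𝕜, E × E) 𝓘(𝕜, E) ω (Prod.snd : E × E → E) (z, z) :=
    contDiff_snd.contMDiff.contMDiffAt
  have hmul := (hsymm.comp_of_eq hfst rfl).mul (hsymm.comp_of_eq hsnd rfl)
  refine (contMDiffAt_extChartAt (I := 𝓘(𝕜, E)) (x := (1 : G))).comp_of_eq hmul ?_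
  simp [hz]

theorem analyticAt_inUnitChart [CompleteSpace E] [LieGroup 𝓘(𝕜, E) ω G]
    {F : G → G}
    (hF : ContMDiffAt 𝓘(𝕜, E) 𝓘(𝕜, E) ω F 1) (hF1 : F 1 = 1) :
    AnalyticAt 𝕜 (inUnitChart 𝕜 F) (extChartAt 𝓘(𝕜, E) (1 : G) 1) := by
  refine ContDiffAt.analyticAt (contMDiffAt_iff_contDiffAt.mp ?_)
  set z := extChartAt 𝓘(𝕜, E) (1 : G) 1 with hz
  have hsymm : ContMDiffAt 𝓘(𝕜, E) 𝓘(𝕜, E) ω (extChartAt 𝓘(𝕜, E) (1 : G)).symm z :=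
    (contMDiffOn_extChartAt_symm (1 : G)).contMDiffAt (extChartAt_target_mem_nhds (1 : G))
  exact (contMDiffAt_extChartAt (I := 𝓘(𝕜, E)) (x := (1 : G))).comp_of_eq
    (hF.comp_of_eq hsymm (by simp [hz])) (by simp [hz, hF1])

/-- The derivative of the `n`-th power map at `1` is multiplication by `n`. -/
theorem hasStrictFDerivAt_inUnitChart_pow [CompleteSpace E] [LieGroup 𝓘(𝕜, E) ω G] (n : ℕ) :
    HasStrictFDerivAt (inUnitChart 𝕜 (fun x : G => x ^ n))
      ((n : 𝕜) • ContinuousLinearMap.id 𝕜 E) (extChartAt 𝓘(𝕜, E) (1 : G) 1) := by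
  set φ := extChartAt 𝓘(𝕜, E) (1 : G) with hφ
  set z := φ 1 with hz
  have hz1 : φ.symm z = 1 := by simp [hz, hφ]
  obtain ⟨L, hL⟩ : ∃ L, HasStrictFDerivAt
      (fun q : E × E => φ (φ.symm q.1 * φ.symm q.2)) L (z, z) :=
    ⟨_, (analyticAt_inUnitChart_mul (𝕜 := 𝕜) (G := G)).hasStrictFDerivAt⟩
  have hright : ∀ᶠ y in 𝓝 z, φ (φ.symm y) = y := by
    filter_upwards [extChartAt_target_mem_nhds (I := 𝓘(𝕜, E)) (1 : G)] with y hy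
    exact φ.right_inv hy
  -- Multiplication by `1` is the identity, so `L` restricts to the identity on each factor and is
  -- therefore addition.
  have hinl : L ∘L ContinuousLinearMap.inl 𝕜 E E = ContinuousLinearMap.id 𝕜 E := by
    have h1 := hL.hasFDerivAt.comp (f := fun y => (y, z)) z
      ((hasFDerivAt_id z).prodMk (hasFDerivAt_const z z))
    refine h1.unique ((hasFDerivAt_id z).congr_of_eventuallyEq ?_)
    filter_upwards [hright] with y hy
    simpa [hz1] using hy
  have hinr : L ∘L ContinuousLinearMap.inr 𝕜 E E = ContinuousLinearMap.id 𝕜 E := by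
    have h1 := hL.hasFDerivAt.comp (f := fun y => (z, y)) z
      ((hasFDerivAt_const z z).prodMk (hasFDerivAt_id z))
    refine h1.unique ((hasFDerivAt_id z).congr_of_eventuallyEq ?_)
    filter_upwards [hright] with y hy
    simpa [hz1] using hy
  have hLadd : ∀ u v, L (u, v) = u + v := by
    intro u v
    have h1 := DFunLike.congr_fun hinl u
    have h2 := DFunLike.congr_fun hinr v
    simp only [ContinuousLinearMap.comp_apply, ContinuousLinearMap.inl_apply,
      ContinuousLinearMap.inr_apply, ContinuousLinearMap.id_apply] at h1 h2
    rw [← h1, ← h2, ← map_add]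
    simp [h1, h2]
  have := topologicalGroup_of_lieGroup 𝓘(𝕜, E) ω (G := G)
  induction n with
  | zero =>
    have : inUnitChart 𝕜 (fun x : G => x ^ 0) = fun _ : E => z := by
      ext y; simp [inUnitChart, hz, hφ]
    rw [this]
    simpa using hasStrictFDerivAt_const z z
  | succ n ih =>
    have h1 : inUnitChart 𝕜 (fun x : G => x ^ n) z = z := inUnitChart_one (one_pow n)
    have h2 := ih.prodMk (hasStrictFDerivAt_id z)
    have h3 : HasStrictFDerivAt (fun q : E × E => φ (φ.symm q.1 * φ.symm q.2)) L
      (inUnitChart 𝕜 (fun x : G => x ^ n) z, id z) := by rw [h1]; exact hL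
    have h4 := HasStrictFDerivAt.comp (f := fun x => (inUnitChart 𝕜 (fun x : G => x ^ n) x, id x)) z h3 h2
    have h5 : L ∘L ((n : 𝕜) • ContinuousLinearMap.id 𝕜 E).prod (ContinuousLinearMap.id 𝕜 E) =
        ((n + 1 : ℕ) : 𝕜) • ContinuousLinearMap.id 𝕜 E := by
      ext v
      simp [hLadd, add_smul]
    rw [h5] at h4
    refine h4.congr_of_eventuallyEq ?_
    have ht : Tendsto (fun y => (φ.symm y) ^ n) (𝓝 z) (𝓝 1) := by
      have h6 := (tendsto_extChartAt_symm_one (𝕜 := 𝕜) (E := E) (G := G)).pow n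
      rwa [one_pow] at h6
    filter_upwards [ht.eventually (extChartAt_source_mem_nhds (I := 𝓘(𝕜, E)) (1 : G))] with y hy
    simp only [inUnitChart, Function.comp_apply, id, pow_succ]
    rw [← hφ, φ.left_inv hy]

theorem contMDiff_conj [LieGroup 𝓘(𝕜, E) ω G] (g : G) :
    ContMDiff 𝓘(𝕜, E) 𝓘(𝕜, E) ω (fun x : G => g * x * g⁻¹) :=
  (contMDiff_const.mul contMDiff_id).mul contMDiff_const

end LieGroup

/-- The Taylor polynomial of degree at most 1 is `z + y`, so only the quadratic remainder is left.
-/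
theorem isBigO_sub_self_sq {𝕜 : Type*} [NontriviallyNormedField 𝕜] {E : Type*}
    [NormedAddCommGroup E] [NormedSpace 𝕜 E] {f : E → E} {z : E} (hf : AnalyticAt 𝕜 f z)
    (hfz : f z = z) (hd : fderiv 𝕜 f z = ContinuousLinearMap.id 𝕜 E) :
    (fun y => f y - y) =O[𝓝 z] fun y => ‖y - z‖ ^ 2 := by
  obtain ⟨P, hP⟩ := hf
  have h := hP.isBigO_sub_partialSum_pow 2
  have h1 : ∀ y, P.partialSum 2 y = z + y := by
    intro y
    have h2 := hP.fderiv_eq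
    rw [hd] at h2
    have h3 := DFunLike.congr_fun h2 y
    rw [FormalMultilinearSeries.partialSum, Finset.sum_range_succ, Finset.sum_range_one,
      hP.coeff_zero, hfz]
    congr 1
    rw [continuousMultilinearCurryFin1_apply] at h3
    refine Eq.trans (congrArg (P 1) ?_) h3.symm
    ext i
    simp [Fin.snoc]
  have hsub : Tendsto (fun y => y - z) (𝓝 z) (𝓝 0) := by
    simpa using (continuous_sub_right z).tendsto z
  refine (h.comp_tendsto hsub).congr' (Eventually.of_forall fun y => ?_) (by rfl)
  simp [h1]

/-! ### The kernel of the adjoint action -/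

section padic

variable {p : ℕ} [Fact p.Prime] {E : Type v} [NormedAddCommGroup E] [NormedSpace ℚ_[p] E]
  {G : Type u} [TopologicalSpace G] [ChartedSpace E G] [Group G] [LieGroup 𝓘(ℚ_[p], E) ω G]

theorem adjointMap_eq_fderiv (g : G) :
    adjointMap p E G g = fderiv ℚ_[p] (inUnitChart ℚ_[p] (fun x : G => g * x * g⁻¹))
      (extChartAt 𝓘(ℚ_[p], E) (1 : G) 1) := by
  -- With the base point a variable, the equation can be substituted and the `cast` disappears.
  have hcast : ∀ (y : G) (h : y = 1) (T : E →L[ℚ_[p]] E),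
      cast (congrArg (fun y : G => TangentSpace 𝓘(ℚ_[p], E) (1 : G) →L[ℚ_[p]]
        TangentSpace 𝓘(ℚ_[p], E) y) h) T = T := by
    rintro y rfl T; rfl
  have hmd : MDifferentiableAt 𝓘(ℚ_[p], E) 𝓘(ℚ_[p], E) (fun x : G => g * x * g⁻¹) 1 :=
    (contMDiff_conj g).contMDiffAt.mdifferentiableAt (by simp)
  have h1 : g * 1 * g⁻¹ = 1 := by group
  have hwrit : writtenInExtChartAt 𝓘(ℚ_[p], E) 𝓘(ℚ_[p], E) 1 (fun x : G => g * x * g⁻¹) =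
      inUnitChart ℚ_[p] (fun x : G => g * x * g⁻¹) := by
    rw [writtenInExtChartAt, h1]; rfl
  refine (hcast _ h1 (mfderiv 𝓘(ℚ_[p], E) 𝓘(ℚ_[p], E) (fun x : G => g * x * g⁻¹) 1)).trans ?_
  refine hmd.mfderiv.trans ?_
  rw [hwrit, ModelWithCorners.range_eq_univ, fderivWithin_univ]

/-- An element with trivial adjoint action centralizes a neighbourhood of `1`. -/
theorem eventually_commute_of_adjointMap_eq_id [CompleteSpace E] {g : G}
    (hg : adjointMap p E G g =
      ContinuousLinearMap.id ℚ_[p] (GroupLieAlgebra 𝓘(ℚ_[p], E) G)) :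
    ∀ᶠ x in 𝓝 (1 : G), Commute g x := by
  have := topologicalGroup_of_lieGroup 𝓘(ℚ_[p], E) ω (G := G)
  set c : G → G := fun x => g * x * g⁻¹ with hc
  have hc1 : c 1 = 1 := by simp [hc]
  have hcd : ContMDiff 𝓘(ℚ_[p], E) 𝓘(ℚ_[p], E) ω c := contMDiff_conj g
  have hcc : Continuous c := hcd.continuous
  have hpc : Continuous fun x : G => x ^ p := continuous_pow p
  have hcomm : ∀ᶠ y in 𝓝 (extChartAt 𝓘(ℚ_[p], E) (1 : G) 1),
      inUnitChart ℚ_[p] c (inUnitChart ℚ_[p] (fun x : G => x ^ p) y) =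
        inUnitChart ℚ_[p] (fun x : G => x ^ p) (inUnitChart ℚ_[p] c y) := by
    filter_upwards [inUnitChart_comp (𝕜 := ℚ_[p]) (F := c) hpc.continuousAt (one_pow p),
      inUnitChart_comp (𝕜 := ℚ_[p]) (F := fun x : G => x ^ p) hcc.continuousAt hc1] with y h1 h2
    rw [h1, h2]
    congr 1
    ext x
    simp [hc, conj_pow]
  have hz := inUnitChart_one (𝕜 := ℚ_[p]) (E := E) hc1
  have hfix := eventually_eq_self_of_commute_padic
    (isBigO_sub_self_sq (analyticAt_inUnitChart hcd.contMDiffAt hc1) hz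
      ((adjointMap_eq_fderiv g).symm.trans hg))
    (inUnitChart_one (one_pow p)) (hasStrictFDerivAt_inUnitChart_pow p) hcomm
  have hct : Tendsto c (𝓝 1) (𝓝 1) := by simpa [hc1] using hcc.tendsto 1
  filter_upwards [(continuousAt_extChartAt (I := 𝓘(ℚ_[p], E)) (1 : G)).eventually hfix,
    extChartAt_source_mem_nhds (I := 𝓘(ℚ_[p], E)) (1 : G),
    hct.eventually (extChartAt_source_mem_nhds (I := 𝓘(ℚ_[p], E)) (1 : G))] with x h1 h2 h3
  simp only [inUnitChart, Function.comp_apply] at h1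
  rw [PartialEquiv.left_inv _ h2] at h1
  -- Equality in the chart descends to `G` since both points lie in the chart domain.
  have h4 : g * x * g⁻¹ = x := (extChartAt 𝓘(ℚ_[p], E) (1 : G)).injOn h3 h2 h1
  exact mul_inv_eq_iff_eq_mul.mp h4

end padic

open scoped Manifold ContDiff in
theorem proposition4 {p : ℕ} [Fact p.Prime]
    {E : Type v} [NormedAddCommGroup E] [NormedSpace ℚ_[p] E] [FiniteDimensional ℚ_[p] E]
    {G : Type u} [TopologicalSpace G] [ChartedSpace E G] [Group G]
    [LieGroup 𝓘(ℚ_[p], E) ω G] (hG : IsExtraordinary p E G) :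
    (∃ H : ℕ → Subgroup G, Monotone H ∧ (∀ n, IsOpen (H n : Set G)) ∧
      (⋃ n, (H n : Set G)) = Set.univ ∧
      ∀ n, IsOpen (Subgroup.center (H n) : Set (H n))) ∧
    (SigmaCompactSpace G → IsElementary G ∧ constructionRank G ≤ ((2 : Ordinal.{u}) : WithTop Ordinal.{u})) := by
  have : ProperSpace E := FiniteDimensional.proper ℚ_[p] E
  have := totallyDisconnectedSpace_of_padic p E
  have := topologicalGroup_of_lieGroup 𝓘(ℚ_[p], E) ω (G := G)
  -- Topological groups are regular, so T1 already gives Hausdorff.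
  have := ChartedSpace.t1Space E G
  have := ChartedSpace.locallyCompactSpace E G
  have := ChartedSpace.totallyDisconnectedSpace E G
  have := ChartedSpace.firstCountableTopology E G
  obtain ⟨H, hm, ho, hu, hZ⟩ := exists_monotone_isOpen_center fun g =>
    eventually_commute_of_adjointMap_eq_id (hG.adjoint_trivial g)
  refine ⟨⟨H, hm, ho, hu, hZ⟩, fun _ => ?_⟩
  have := ChartedSpace.secondCountable_of_sigmaCompact E G
  exact isElementary_and_constructionRank_le_two
    ⟨inferInstance, inferInstance, inferInstance, inferInstance, inferInstance⟩ hm ho hu hZ
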